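/- Proposition 5.7. Let $\mathbf I$ be a finitely generated, connected, upward-simply-connected category, and let $\mathbf C$ be a category with the amalgamation property. Then every functor $F:\mathbf I\to\mathbf C$ has a cocone, i.e. there are an object $X$ of $\mathbf C$ and morphisms $f_I:F(I)\to X$ for all objects $I$ of $\mathbf I$ such that $f_I=f_J\circ F(i)$ for every $i:I\to J$ in $\mathbf I$. Here: - $\mathbf I$ is *finitely generated* if there are finitely many arrows of $\mathbf I$ whose closure under (binary) composition consists of all arrows of $\mathbf I$, identities included; so $\mathbf I$ has finitely many objects. - $\mathbf I$ is *connected* if it is non-empty and any two objects are joined by a zigzag of morphisms. - $\mathbf C$ has the *amalgamation property* (AP) if every diagram of shape $\bullet\leftarrow\bullet\rightarrow\bullet$ in $\mathbf C$ has a cocone. - An *inverse category* is a category in which every morphism $f:X\to Y$ has a unique pseudoinverse $f^{-1}:Y\to X$, i.e. a morphism with $f\circ f^{-1}\circ f=f$ and $f^{-1}\circ f\circ f^{-1}=f^{-1}$. - The *left fundamental inverse category* $\mathcal L(\mathbf I)$ is the inverse category freely generated by $\mathbf I$ such that every morphism of $\mathbf I$ becomes monic: there is a functor $\eta:\mathbf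 I\to\mathcal L(\mathbf I)$ with $\eta(i)^{-1}\circ\eta(i)=1$ for all arrows $i$ of $\mathbf I$, and every functor $G$ from $\mathbf I$ to an inverse category with $G(i)^{-1}\circ G(i)=1$ for all $i$ factors uniquely through $\eta$. - $\mathbf I$ is *upward-simply-connected* if $\mathcal L(\mathbf I)$ is idempotent, i.e. $f\circ f=f$ for every endomorphism $f$ in $\mathcal L(\mathbf I)$. -/

import Mathlib

open CategoryTheory

universe v u v' u'

/-- The closure of a set of arrows under binary composition. -/
inductive ArrowClosure {I : Type u} [Category.{v} I] (S : Set (Arrow I)) :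
    ∀ {X Y : I}, (X ⟶ Y) → Prop
  | of {X Y : I} (f : X ⟶ Y) (hf : Arrow.mk f ∈ S) : ArrowClosure S f
  | comp {X Y Z : I} (f : X ⟶ Y) (g : Y ⟶ Z) (hf : ArrowClosure S f) (hg : ArrowClosure S g) :
      ArrowClosure S (f ≫ g)

/-- A category is finitely generated if there are finitely many arrows whose closure under binary
composition consists of all arrows.  Identities are not included for free, so that a finitely
generated category has only finitely many objects. -/
def FinitelyGeneratedCategory (I : Type u) [Category.{v} I] : Prop :=
  ∃ S : Set (Arrow I), S.Finite ∧ ∀ (X Y : I) (f : X ⟶ Y), ArrowClosure S f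

/-- The amalgamation property: every diagram of shape `• ⟵ • ⟶ •` has a cocone. -/
def AmalgamationProperty (C : Type u) [Category.{v} C] : Prop :=
  ∀ F : Limits.WalkingSpan ⥤ C, Nonempty (Limits.Cocone F)

/-- A category is idempotent if each of its endomorphisms is idempotent. -/
def IdempotentCategory (C : Type u) [Category.{v} C] : Prop :=
  ∀ (X : C) (f : X ⟶ X), f ≫ f = f

/-- `g` is a pseudoinverse of `f`. -/
def IsPseudoinverse {C : Type u} [Category.{v} C] {X Y : C} (f : X ⟶ Y) (g : Y ⟶ X) : Prop :=
  f ≫ g ≫ f = f ∧ g ≫ f ≫ g = g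

/-- An inverse category: every morphism has a unique pseudoinverse. -/
def InverseCategory (C : Type u) [Category.{v} C] : Prop :=
  ∀ (X Y : C) (f : X ⟶ Y), ∃! g : Y ⟶ X, IsPseudoinverse f g

/-! ### The left fundamental inverse category

It is built as the free algebra: formal words in the arrows of `I`, identities, composites and
pseudoinverses, modulo the least congruence which forces exactly the axioms. -/

/-- Formal words over `I`, with composition in diagrammatic order. -/
inductive LWord (I : Type u) [Category.{v} I] : I → I → Type (max u v)
  | of {X Y : I} (i : X ⟶ Y) : LWord I X Y
  | id (X : I) : LWord I X X
  | comp {X Y Z : I} (f : LWord I X Y) (g : LWord I Y Z) : LWord I X Z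
  | inv {X Y : I} (f : LWord I X Y) : LWord I Y X

/-- The least congruence on formal words such that the quotient is an inverse category in which
`inv` gives the pseudoinverses, `of` is functorial, and `of i` followed by `inv (of i)` is an
identity for every arrow `i` of `I`. -/
inductive LRel (I : Type u) [Category.{v} I] : ∀ {X Y : I}, LWord I X Y → LWord I X Y → Prop
  | refl {X Y : I} (f : LWord I X Y) : LRel I f f
  | symm {X Y : I} {f g : LWord I X Y} : LRel I f g → LRel I g f
  | trans {X Y : I} {f g h : LWord I X Y} : LRel I f g → LRel I g h → LRel I f h
  | comp {X Y Z : I} {f f' : LWord I X Y} {g g' : LWord I Y Z} :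
      LRel I f f' → LRel I g g' → LRel I (f.comp g) (f'.comp g')
  | id_comp {X Y : I} (f : LWord I X Y) : LRel I ((LWord.id X).comp f) f
  | comp_id {X Y : I} (f : LWord I X Y) : LRel I (f.comp (LWord.id Y)) f
  | assoc {W X Y Z : I} (f : LWord I W X) (g : LWord I X Y) (h : LWord I Y Z) :
      LRel I ((f.comp g).comp h) (f.comp (g.comp h))
  | of_id (X : I) : LRel I (LWord.of (𝟙 X)) (LWord.id X)
  | of_comp {X Y Z : I} (i : X ⟶ Y) (j : Y ⟶ Z) :
      LRel I (LWord.of (i ≫ j)) ((LWord.of i).comp (LWord.of j))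
  | comp_inv_comp {X Y : I} (f : LWord I X Y) : LRel I (f.comp (f.inv.comp f)) f
  | inv_comp_inv {X Y : I} (f : LWord I X Y) : LRel I (f.inv.comp (f.comp f.inv)) f.inv
  | inv_unique {X Y : I} (f : LWord I X Y) (g : LWord I Y X) :
      LRel I (f.comp (g.comp f)) f → LRel I (g.comp (f.comp g)) g → LRel I g f.inv
  | monic {X Y : I} (i : X ⟶ Y) :
      LRel I ((LWord.of i).comp (LWord.of i).inv) (LWord.id X)

/-- The congruence `LRel` as a setoid. -/
def LSetoid (I : Type u) [Category.{v} I] (X Y : I) : Setoid (LWord I X Y) :=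
  ⟨LRel I, LRel.refl, LRel.symm, LRel.trans⟩

/-- The left fundamental inverse category of `I`: it has the same objects as `I`. -/
structure LeftFundamental (I : Type u) where
  of ::
  /-- The underlying object of `I`. -/
  as : I

namespace LeftFundamental

instance category (I : Type u) [Category.{v} I] :
    Category.{max u v} (LeftFundamental I) where
  Hom X Y := Quotient (LSetoid I X.as Y.as)
  id X := Quotient.mk _ (LWord.id X.as)
  comp := fun f g => Quotient.map₂ LWord.comp (fun _ _ h _ _ h' => LRel.comp h h') f g
  id_comp := by
    rintro X Y ⟨f⟩
    exact Quotient.sound (LRel.id_comp f)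
  comp_id := by
    rintro X Y ⟨f⟩
    exact Quotient.sound (LRel.comp_id f)
  assoc := by
    rintro W X Y Z ⟨f⟩ ⟨g⟩ ⟨h⟩
    exact Quotient.sound (LRel.assoc f g h)

/-- The class of a formal word. -/
def mk {I : Type u} [Category.{v} I] {X Y : I} (w : LWord I X Y) :
    LeftFundamental.of X ⟶ LeftFundamental.of Y :=
  Quotient.mk (LSetoid I X Y) w

/-- The canonical functor from `I` to its left fundamental inverse category. -/
def η (I : Type u) [Category.{v} I] : I ⥤ LeftFundamental I where
  obj X := ⟨X⟩
  map i := mk (LWord.of i)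
  map_id X := Quotient.sound (LRel.of_id X)
  map_comp i j := Quotient.sound (LRel.of_comp i j)


/-- The left fundamental inverse category is an inverse category. -/
theorem inverseCategory (I : Type u) [Category.{v} I] : InverseCategory (LeftFundamental I) := by
  rintro ⟨X⟩ ⟨Y⟩ f
  induction f using Quotient.inductionOn with
  | _ f =>
    refine ⟨mk f.inv, ⟨Quotient.sound (LRel.comp_inv_comp f),
      Quotient.sound (LRel.inv_comp_inv f)⟩, ?_⟩
    intro g
    induction g using Quotient.inductionOn with
    | _ g =>
      rintro ⟨h₁, h₂⟩
      exact Quotient.sound (LRel.inv_unique f g (Quotient.exact h₁) (Quotient.exact h₂))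

/-- Every arrow of `I` becomes monic: its image followed by the pseudoinverse is an identity. -/
theorem η_monic {I : Type u} [Category.{v} I] {X Y : I} (i : X ⟶ Y)
    (g : (η I).obj Y ⟶ (η I).obj X) (hg : IsPseudoinverse ((η I).map i) g) :
    (η I).map i ≫ g = 𝟙 _ := by
  have h : g = mk (LWord.of i).inv := (inverseCategory I _ _ ((η I).map i)).unique hg
    ⟨Quotient.sound (LRel.comp_inv_comp _), Quotient.sound (LRel.inv_comp_inv _)⟩
  subst h
  exact Quotient.sound (LRel.monic i)

/-- Evaluation of a formal word in an inverse category. -/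
noncomputable def eval {I : Type u} [Category.{v} I] {D : Type u'} [Category.{v'} D]
    (hD : InverseCategory D) (F : I ⥤ D) : ∀ {X Y : I}, LWord I X Y → (F.obj X ⟶ F.obj Y)
  | _, _, .of i => F.map i
  | _, _, .id X => 𝟙 (F.obj X)
  | _, _, .comp f g => eval hD F f ≫ eval hD F g
  | _, _, .inv f => (hD _ _ (eval hD F f)).choose

theorem eval_eq {I : Type u} [Category.{v} I] {D : Type u'} [Category.{v'} D]
    (hD : InverseCategory D) (F : I ⥤ D)
    (hF : ∀ {X Y : I} (i : X ⟶ Y) (g : F.obj Y ⟶ F.obj X),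
      IsPseudoinverse (F.map i) g → F.map i ≫ g = 𝟙 _)
    {X Y : I} {f g : LWord I X Y} (h : LRel I f g) : eval hD F f = eval hD F g := by
  induction h with
  | refl => rfl
  | symm _ ih => exact ih.symm
  | trans _ _ ih ih' => exact ih.trans ih'
  | comp _ _ ih ih' => simp only [eval, ih, ih']
  | id_comp => simp [eval]
  | comp_id => simp [eval]
  | assoc => simp [eval]
  | of_id => simp [eval]
  | of_comp => simp [eval]
  | comp_inv_comp f => exact (hD _ _ (eval hD F f)).choose_spec.1.1
  | inv_comp_inv f => exact (hD _ _ (eval hD F f)).choose_spec.1.2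
  | inv_unique f g _ _ ih ih' => exact (hD _ _ (eval hD F f)).choose_spec.2 _ ⟨ih, ih'⟩
  | monic i => exact hF i _ (hD _ _ (F.map i)).choose_spec.1

/-- The universal property: a functor from `I` to an inverse category, every value `F i` of which
is monic (that is, `F i` followed by its pseudoinverse is an identity), factors uniquely through
the canonical functor. -/
theorem existsUnique_lift {I : Type u} [Category.{v} I] {D : Type u'} [Category.{v'} D]
    (hD : InverseCategory D) (F : I ⥤ D)
    (hF : ∀ {X Y : I} (i : X ⟶ Y) (g : F.obj Y ⟶ F.obj X),
      IsPseudoinverse (F.map i) g → F.map i ≫ g = 𝟙 _) :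
    ∃! G : LeftFundamental I ⥤ D, η I ⋙ G = F := by
  let G : LeftFundamental I ⥤ D :=
    { obj := fun X => F.obj X.as
      map := fun f => Quotient.lift (eval hD F) (fun _ _ h => eval_eq hD F hF h) f
      map_id := fun _ => rfl
      map_comp := by
        rintro X Y Z ⟨f⟩ ⟨g⟩
        rfl }
  refine ⟨G, rfl, ?_⟩
  rintro G' rfl
  have key : ∀ {X Y : I} (w : LWord I X Y), G'.map (mk w) = eval hD (η I ⋙ G') w := by
    intro X Y w
    induction w with
    | of i => rfl
    | id X => exact G'.map_id _
    | comp f g ih ih' =>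
      exact (G'.map_comp (mk f) (mk g)).trans (by rw [ih, ih']; rfl)
    | inv f ih =>
      refine (hD _ _ (eval hD (η I ⋙ G') f)).choose_spec.2 _ ?_
      have h₁ : mk f ≫ mk f.inv ≫ mk f = mk f := Quotient.sound (LRel.comp_inv_comp f)
      have h₂ : mk f.inv ≫ mk f ≫ mk f.inv = mk f.inv := Quotient.sound (LRel.inv_comp_inv f)
      rw [← ih]
      constructor
      · have e := congrArg (fun t => G'.map t) h₁
        simp only [Functor.map_comp] at e
        exact e
      · have e := congrArg (fun t => G'.map t) h₂
        simp only [Functor.map_comp] at e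
        exact e
  refine CategoryTheory.Functor.hext (fun _ => rfl) ?_
  rintro ⟨X⟩ ⟨Y⟩ ⟨w⟩
  exact heq_of_eq (key w)

end LeftFundamental

/-- A category is upward-simply-connected if its left fundamental inverse category is
idempotent. -/
def UpwardSimplyConnected (I : Type u) [Category.{v} I] : Prop :=
  IdempotentCategory (LeftFundamental I)

universe w

/-!
Partial injections form an inverse category, so a functor from an upward-simply-connected category
to sets with injective transition maps has no monodromy: a zigzag of elements which returns to its
first fibre returns to its first element. This property passes to upward closed full subcategories,
and it is used for two functors. Under the amalgamation property, being coequalized by some arrow is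
an equivalence relation, and `B ↦ Hom(A, B)` modulo it is a functor with injective transition maps;
hence `F f` and `F g` are coequalized by some arrow for all parallel `f`, `g`. A labelling of the
arrows which enter an upward closed class from outside gives the second one; hence arrows from one
object into one connected component of the class have the same label.

The cocone is found by induction on the number of objects. Let `x` be minimal for the existence of
arrows, and let `W` be the class of the objects without an arrow to `x`. Each component of `W` is
smaller, has a cocone by induction, and receives an arrow from `x`, so that finitely many
amalgamations over `F x` put these cocones together to a cocone on `W`. It extends to the objects
outside `W`, which have arrows to and from `x`, if all composites `F x ⟶ F w ⟶ β` with `w` in `W`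
agree up to coequalizability; they do by the second use of trivial monodromy. Finitely many
generators are then coequalized at once.
-/

section PartialInjections

/-- The objects of the category of sets and partial injections. -/
structure PInj : Type (w + 1) where
  carrier : Type w

namespace PInj

instance category : Category.{w} PInj.{w} where
  Hom X Y := X.carrier ≃. Y.carrier
  id X := PEquiv.refl X.carrier
  comp f g := f.trans g
  id_comp f := f.refl_trans
  comp_id f := f.trans_refl
  assoc f g h := f.trans_assoc g h

variable {X Y Z : PInj.{w}}

theorem mem_comp (f : X ⟶ Y) (g : Y ⟶ Z) {a : X.carrier} {c : Z.carrier} :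
    c ∈ (f ≫ g).toFun a ↔ ∃ b, b ∈ f.toFun a ∧ c ∈ g.toFun b :=
  PEquiv.mem_trans f g a c

theorem hom_ext {f g : X ⟶ Y} (h : ∀ a b, b ∈ f.toFun a ↔ b ∈ g.toFun a) : f = g :=
  PEquiv.ext fun a => Option.ext (h a)

theorem mem_of_comp_comp_eq {f : X ⟶ Y} {g : Y ⟶ X} (h : f ≫ g ≫ f = f) {a : X.carrier}
    {b : Y.carrier} (hab : b ∈ f.toFun a) : a ∈ g.toFun b := by
  have hab' := hab
  rw [← h] at hab'
  simp only [mem_comp] at hab'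
  obtain ⟨b', hb', a', ha', hb⟩ := hab'
  obtain rfl := Option.mem_unique hab hb'
  obtain rfl := PEquiv.inj f hab hb
  exact ha'

theorem comp_symm_comp (f : X ⟶ Y) : f ≫ (show Y ⟶ X from PEquiv.symm f) ≫ f = f := by
  refine hom_ext fun a b => ?_
  simp only [mem_comp]
  constructor
  · rintro ⟨b', hb', a', ha', hb⟩
    exact PEquiv.inj f hb' ((PEquiv.mem_iff_mem f).1 ha') ▸ hb
  · exact fun hb => ⟨b, hb, a, (PEquiv.mem_iff_mem f).2 hb, hb⟩

theorem inverseCategory : InverseCategory PInj.{w} := by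
  intro X Y f
  refine ⟨PEquiv.symm f, ⟨comp_symm_comp f, comp_symm_comp (show Y ⟶ X from PEquiv.symm f)⟩, ?_⟩
  rintro g ⟨hfgf, hgfg⟩
  exact hom_ext fun b a => ⟨fun h => (PEquiv.mem_iff_mem f).2 (mem_of_comp_comp_eq hgfg h),
    fun h => mem_of_comp_comp_eq hfgf ((PEquiv.mem_iff_mem f).1 h)⟩

/-- An injective function, as a partial injection. -/
noncomputable def ofInjective {α β : Type w} (f : α → β) (hf : f.Injective) :
    PInj.mk α ⟶ PInj.mk β where
  toFun a := some (f a)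
  invFun := Function.partialInv f
  inv a b := (hf.isPartialInv a b).trans Option.some_inj.symm

theorem ofInjective_comp_eq_id {α β : Type w} {f : α → β} (hf : f.Injective)
    {g : PInj.mk β ⟶ PInj.mk α} (h : IsPseudoinverse (ofInjective f hf) g) :
    ofInjective f hf ≫ g = 𝟙 _ := by
  refine PEquiv.ext fun a => ?_
  exact Option.mem_def.1 ((mem_comp _ _).2 ⟨f a, rfl, mem_of_comp_comp_eq h.1 rfl⟩)

variable {I : Type u} [Category.{v} I]

/-- A functor to sets whose transition maps are injective, as a functor to partial injections. -/
noncomputable def functorOfInjective (G : I ⥤ Type w)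
    (hG : ∀ ⦃X Y : I⦄ (i : X ⟶ Y), Function.Injective (G.map i)) : I ⥤ PInj.{w} where
  obj X := ⟨G.obj X⟩
  map i := ofInjective (G.map i) (hG i)
  map_id _ := PEquiv.ext fun a => congrArg some (G.map_id_apply _ a)
  map_comp i j := PEquiv.ext fun a => congrArg some (G.map_comp_apply i j a)

end PInj

end PartialInjections

section Monodromy

variable {I : Type u} [Category.{v} I]

/-- A category has trivial monodromy if, in every functor to sets with injective transition maps,
each zigzag of elements which returns to the same fibre returns to the same element. -/
def HasTrivialMonodromy (I : Type u) [Category.{v} I] : Prop :=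
  ∀ G : I ⥤ Type w, (∀ ⦃X Y : I⦄ (i : X ⟶ Y), Function.Injective (G.map i)) →
    ∀ ⦃X : I⦄ ⦃a b : G.obj X⦄, Zigzag (G.elementsMk X a) (G.elementsMk X b) → a = b

theorem exists_word_of_zigzag {G : I ⥤ Type w}
    (hG : ∀ ⦃X Y : I⦄ (i : X ⟶ Y), Function.Injective (G.map i)) {p q : G.Elements}
    (h : Zigzag p q) : ∃ t : LWord I p.1 q.1,
      q.2 ∈ (LeftFundamental.eval PInj.inverseCategory (PInj.functorOfInjective G hG) t).toFun
        p.2 := by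
  induction h with
  | refl => exact ⟨.id _, rfl⟩
  | tail _ h ih =>
    obtain ⟨t, ht⟩ := ih
    obtain ⟨⟨i, hi⟩⟩ | ⟨⟨i, hi⟩⟩ := h
    · exact ⟨t.comp (.of i), (PInj.mem_comp _ _).2 ⟨_, ht, congrArg some hi⟩⟩
    · refine ⟨t.comp (.inv (.of i)), (PInj.mem_comp _ _).2 ⟨_, ht, ?_⟩⟩
      exact PInj.mem_of_comp_comp_eq (PInj.inverseCategory _ _ _).choose_spec.1.1 (congrArg some hi)

theorem UpwardSimplyConnected.hasTrivialMonodromy (hI : UpwardSimplyConnected I) :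
    HasTrivialMonodromy.{v, u, w} I := by
  intro G hG X a b hab
  obtain ⟨t, ht⟩ := exists_word_of_zigzag hG hab
  have ht₂ := ht
  have t_idem : LRel I (t.comp t) t := Quotient.exact (hI ⟨X⟩ (LeftFundamental.mk t))
  rw [← LeftFundamental.eval_eq PInj.inverseCategory (PInj.functorOfInjective G hG)
    (fun i _ => PInj.ofInjective_comp_eq_id (hG i)) t_idem] at ht₂
  obtain ⟨c, hc, hcb⟩ := (PInj.mem_comp _ _).1 ht₂
  obtain rfl := Option.mem_unique ht hc
  exact PEquiv.inj _ ht hcb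

/-- A class of objects is upward closed if it is a cosieve: it contains the target of every arrow
whose source it contains. -/
def UpwardClosed (P : ObjectProperty I) : Prop :=
  ∀ ⦃X Y : I⦄, (X ⟶ Y) → P X → P Y

variable {P : ObjectProperty I}

/-- An arrow whose source lies in an upward closed class, as an arrow of the full subcategory. -/
abbrev UpwardClosed.homMk (hP : UpwardClosed P) {X Y : I} (f : X ⟶ Y) (hX : P X) :
    (⟨X, hX⟩ : P.FullSubcategory) ⟶ ⟨Y, hP f hX⟩ :=
  ObjectProperty.homMk f

/-- The extension by the empty set of a functor defined on an upward closed class of objects. -/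
def extendByEmpty (hP : UpwardClosed P) (G : P.FullSubcategory ⥤ Type w) : I ⥤ Type w where
  obj X := Σ' hX : P X, G.obj ⟨X, hX⟩
  map f := TypeCat.ofHom fun a => ⟨hP f a.1, G.map (hP.homMk f a.1) a.2⟩
  map_id X := ConcreteCategory.hom_ext _ _ fun a =>
    congrArg (β := Σ' hX : P X, G.obj ⟨X, hX⟩) (PSigma.mk a.1) (G.map_id_apply ⟨X, a.1⟩ a.2)
  map_comp {_ _ Z} f g := ConcreteCategory.hom_ext _ _ fun a =>
    congrArg (β := Σ' hZ : P Z, G.obj ⟨Z, hZ⟩) (PSigma.mk _)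
      (G.map_comp_apply (hP.homMk f a.1) (hP.homMk g (hP f a.1)) a.2)

/-- The elements of `G`, as elements of its extension by the empty set. -/
def elementsExtendByEmpty (hP : UpwardClosed P) (G : P.FullSubcategory ⥤ Type w) :
    G.Elements ⥤ (extendByEmpty hP G).Elements where
  obj p := ⟨p.1.obj, p.1.property, p.2⟩
  map f := ⟨f.1.hom, congrArg (PSigma.mk _) f.2⟩

theorem HasTrivialMonodromy.fullSubcategory (hI : HasTrivialMonodromy.{v, u, w} I)
    (hP : UpwardClosed P) : HasTrivialMonodromy.{v, u, w} P.FullSubcategory := by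
  intro G hG X a b hab
  have extend_injective : ∀ ⦃Y Z : I⦄ (i : Y ⟶ Z),
      Function.Injective ((extendByEmpty hP G).map i) := by
    rintro Y Z i ⟨hY, c⟩ ⟨_, d⟩ hcd
    exact congrArg (PSigma.mk hY) (hG _ (eq_of_heq (PSigma.mk.inj hcd).2))
  have eq_extend : (⟨X.property, a⟩ : (extendByEmpty hP G).obj X.obj) = ⟨X.property, b⟩ :=
    hI _ extend_injective (zigzag_obj_of_zigzag (elementsExtendByEmpty hP G) hab)
  exact eq_of_heq (PSigma.mk.inj eq_extend).2

end Monodromy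

section EntryLabelling

variable {I : Type u} [Category.{v} I] {P : ObjectProperty I} {T : Type w}

/-- A labelling of the arrows which enter a class `P` of objects from outside. The label does not
change when the arrow is composed with an arrow inside `P` or with one outside `P`. -/
structure EntryLabelling (P : ObjectProperty I) (T : Type w) where
  label {X Y : I} (f : X ⟶ Y) (hX : ¬ P X) (hY : P Y) : T
  label_comp_of_mem {X Y Z : I} (f : X ⟶ Y) (g : Y ⟶ Z) (hX : ¬ P X) (hY : P Y) (hZ : P Z) :
    label (f ≫ g) hX hZ = label f hX hY
  label_comp_of_notMem {X Y Z : I} (f : X ⟶ Y) (g : Y ⟶ Z) (hX : ¬ P X) (hY : ¬ P Y) (hZ : P Z) :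
    label (f ≫ g) hX hZ = label g hY hZ

namespace EntryLabelling

open Classical in
/-- The functor whose value is `T` on `P` and a point outside `P`, where an arrow entering `P` maps
the point to its label. -/
noncomputable def functor (hP : UpwardClosed P) (τ : EntryLabelling P T) : I ⥤ Type w where
  obj X := P X → T
  map {X Y} f := TypeCat.ofHom fun s hY => if hX : P X then s hX else τ.label f hX hY
  map_id X := by
    ext s hX
    exact dif_pos hX
  map_comp {X Y Z} f g := by
    ext s hZ
    by_cases hX : P X
    · simp [hX, hP f hX]
    by_cases hY : P Y
    · simp [hX, hY, τ.label_comp_of_mem f g hX hY hZ]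
    · simp [hX, hY, τ.label_comp_of_notMem f g hX hY hZ]

theorem functor_map_apply_of_mem (hP : UpwardClosed P) (τ : EntryLabelling P T) {X Y : I}
    (f : X ⟶ Y) (s : P X → T) (hX : P X) (hY : P Y) : (τ.functor hP).map f s hY = s hX :=
  dif_pos hX

theorem functor_map_apply_of_notMem (hP : UpwardClosed P) (τ : EntryLabelling P T) {X Y : I}
    (f : X ⟶ Y) (s : P X → T) (hX : ¬ P X) (hY : P Y) :
    (τ.functor hP).map f s hY = τ.label f hX hY :=
  dif_neg hX

theorem functor_map_injective (hP : UpwardClosed P) (τ : EntryLabelling P T) {X Y : I}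
    (f : X ⟶ Y) : Function.Injective ((τ.functor hP).map f) := by
  intro s s' h
  funext hX
  have := congrFun h (hP f hX)
  rwa [functor_map_apply_of_mem hP τ f s hX, functor_map_apply_of_mem hP τ f s' hX] at this

/-- The element of the fibres over `P` which is constantly equal to `t`. -/
noncomputable def constElements (hP : UpwardClosed P) (τ : EntryLabelling P T) (t : T) :
    P.FullSubcategory ⥤ (τ.functor hP).Elements where
  obj X := ⟨X.obj, fun _ => t⟩
  map {X Y} f := ⟨f.hom, funext fun hY => functor_map_apply_of_mem hP τ f.hom _ X.property hY⟩

theorem label_eq_of_zigzag (hI : HasTrivialMonodromy.{v, u, w} I) (hP : UpwardClosed P)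
    (τ : EntryLabelling P T) {X : I} (hX : ¬ P X) {Y Z : P.FullSubcategory} (f : X ⟶ Y.obj)
    (g : X ⟶ Z.obj) (hYZ : Zigzag Y Z) : τ.label f hX Y.property = τ.label g hX Z.property := by
  let point : (τ.functor hP).Elements := ⟨X, fun h => (hX h).elim⟩
  have enter : ∀ {W : P.FullSubcategory} (k : X ⟶ W.obj),
      Zigzag point ((τ.constElements hP (τ.label k hX W.property)).obj W) := fun k =>
    .of_hom ⟨k, funext fun hW => functor_map_apply_of_notMem hP τ k _ hX hW⟩
  have loop := (zigzag_obj_of_zigzag (τ.constElements hP (τ.label f hX Y.property)) hYZ).symm.trans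
    ((enter f).symm.trans (enter g))
  exact congrFun (hI _ (fun _ _ => τ.functor_map_injective hP) loop) Z.property

end EntryLabelling

end EntryLabelling

section Coequalizable

variable {C : Type u'} [Category.{v'} C]

/-- Two parallel arrows are coequalizable if some arrow out of their common target makes them
equal; this is weaker than having a coequalizer. -/
def Coequalizable {A B : C} (p q : A ⟶ B) : Prop :=
  ∃ (E : C) (k : B ⟶ E), p ≫ k = q ≫ k

namespace Coequalizable

variable {A B : C} {p q : A ⟶ B}

protected theorem refl (p : A ⟶ B) : Coequalizable p p :=
  ⟨B, 𝟙 B, rfl⟩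

protected theorem symm : Coequalizable p q → Coequalizable q p
  | ⟨E, k, hk⟩ => ⟨E, k, hk.symm⟩

theorem comp_left {Z : C} (f : Z ⟶ A) : Coequalizable p q → Coequalizable (f ≫ p) (f ≫ q)
  | ⟨E, k, hk⟩ => ⟨E, k, by simp only [Category.assoc, hk]⟩

theorem of_comp_right {D : C} (g : B ⟶ D) :
    Coequalizable (p ≫ g) (q ≫ g) → Coequalizable p q
  | ⟨E, k, hk⟩ => ⟨E, g ≫ k, by simpa only [Category.assoc] using hk⟩

end Coequalizable

namespace AmalgamationProperty

theorem exists_comp_eq (hC : AmalgamationProperty C) {A B D : C} (f : A ⟶ B) (g : A ⟶ D) :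
    ∃ (E : C) (h : B ⟶ E) (k : D ⟶ E), f ≫ h = g ≫ k := by
  obtain ⟨c⟩ := hC (Limits.span f g)
  exact ⟨c.pt, _, _, Limits.PushoutCocone.condition c⟩

theorem exists_forall_comp_eq (hC : AmalgamationProperty C) {ι : Type*} [Finite ι] {A : C}
    {B : ι → C} (f : ∀ i, A ⟶ B i) :
    ∃ (D : C) (t : A ⟶ D) (k : ∀ i, B i ⟶ D), ∀ i, f i ≫ k i = t := by
  have extend (s : Set ι) (hs : s.Finite) :
      ∃ (D : C) (t : A ⟶ D), ∀ i ∈ s, ∃ k : B i ⟶ D, f i ≫ k = t := by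
    induction s, hs using Set.Finite.induction_on with
    | empty => exact ⟨A, 𝟙 A, fun _ hi => hi.elim⟩
    | @insert i s _ _ ih =>
      obtain ⟨D, t, ht⟩ := ih
      obtain ⟨E, h, k, hk⟩ := hC.exists_comp_eq (f i) t
      refine ⟨E, t ≫ k, fun j hj => ?_⟩
      obtain rfl | hj := hj
      · exact ⟨h, hk⟩
      · obtain ⟨l, hl⟩ := ht j hj
        exact ⟨l ≫ k, by rw [← Category.assoc, hl]⟩
  obtain ⟨D, t, ht⟩ := extend Set.univ Set.finite_univ
  choose k hk using fun i => ht i trivial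
  exact ⟨D, t, k, hk⟩

theorem exists_coequalizing (hC : AmalgamationProperty C) {ι : Type*} [Finite ι] {A : ι → C}
    {B : C} {p q : ∀ i, A i ⟶ B} (h : ∀ i, Coequalizable (p i) (q i)) :
    ∃ (D : C) (k : B ⟶ D), ∀ i, p i ≫ k = q i ≫ k := by
  choose E l hl using h
  obtain ⟨D, t, k, hk⟩ := hC.exists_forall_comp_eq l
  exact ⟨D, t, fun i => by simp only [← hk i, reassoc_of% hl i]⟩

end AmalgamationProperty

variable {A B D : C} {p q r : A ⟶ B}

theorem Coequalizable.comp_right (hC : AmalgamationProperty C) (g : B ⟶ D) :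
    Coequalizable p q → Coequalizable (p ≫ g) (q ≫ g)
  | ⟨_, k, hk⟩ => by
    obtain ⟨E, l, m, hlm⟩ := hC.exists_comp_eq k g
    exact ⟨E, m, by simp only [Category.assoc, ← hlm, reassoc_of% hk]⟩

theorem Coequalizable.trans (hC : AmalgamationProperty C) :
    Coequalizable p q → Coequalizable q r → Coequalizable p r
  | ⟨_, k, hk⟩, ⟨_, l, hl⟩ => by
    obtain ⟨E, m, n, hmn⟩ := hC.exists_comp_eq k l
    exact ⟨E, k ≫ m, by rw [reassoc_of% hk, hmn, reassoc_of% hl]⟩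

/-- Coequalizability as a setoid. -/
def coequalizableSetoid (hC : AmalgamationProperty C) (A B : C) : Setoid (A ⟶ B) where
  r := Coequalizable
  iseqv := ⟨.refl, .symm, .trans hC⟩

/-- The arrows from `A` to `B` modulo coequalizability. -/
def CoequalizableClass (hC : AmalgamationProperty C) (A B : C) : Type v' :=
  Quotient (coequalizableSetoid hC A B)

namespace CoequalizableClass

/-- The class of an arrow modulo coequalizability. -/
def mk (hC : AmalgamationProperty C) (p : A ⟶ B) : CoequalizableClass hC A B :=
  Quotient.mk _ p

theorem mk_eq_mk {hC : AmalgamationProperty C} : mk hC p = mk hC q ↔ Coequalizable p q :=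
  Quotient.eq

/-- The covariant hom functor of `A`, modulo coequalizability. -/
def functor (hC : AmalgamationProperty C) (A : C) : C ⥤ Type v' where
  obj B := CoequalizableClass hC A B
  map g := TypeCat.ofHom (Quotient.map (· ≫ g) fun _ _ => .comp_right hC g)
  map_id _ := ConcreteCategory.hom_ext _ _ <| by
    rintro ⟨p⟩
    exact congrArg (mk hC) (Category.comp_id p)
  map_comp g h := ConcreteCategory.hom_ext _ _ <| by
    rintro ⟨p⟩
    exact congrArg (mk hC) (Category.assoc p g h).symm

theorem functor_map_mk (hC : AmalgamationProperty C) (p : A ⟶ B) (g : B ⟶ D) :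
    (functor hC A).map g (mk hC p) = mk hC (p ≫ g) :=
  rfl

theorem functor_map_injective (hC : AmalgamationProperty C) (g : B ⟶ D) :
    Function.Injective ((functor hC A).map g) := by
  rintro ⟨p⟩ ⟨q⟩ h
  exact mk_eq_mk.2 (.of_comp_right g (mk_eq_mk.1 h))

end CoequalizableClass

theorem HasTrivialMonodromy.coequalizable_map {I : Type u} [Category.{v} I]
    (hI : HasTrivialMonodromy.{v, u, v'} I) (hC : AmalgamationProperty C) (F : I ⥤ C) {X Y : I}
    (f g : X ⟶ Y) : Coequalizable (F.map f) (F.map g) := by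
  let G : I ⥤ Type v' := F ⋙ CoequalizableClass.functor hC (F.obj X)
  have from_id (h : X ⟶ Y) : Zigzag (G.elementsMk X (CoequalizableClass.mk hC (𝟙 (F.obj X))))
      (G.elementsMk Y (CoequalizableClass.mk hC (F.map h))) :=
    .of_hom ⟨h, by
      rw [Functor.comp_map, CoequalizableClass.functor_map_mk, Category.id_comp]⟩
  exact CoequalizableClass.mk_eq_mk.1 <|
    hI G (fun _ _ i => CoequalizableClass.functor_map_injective hC (F.map i))
      ((from_id f).symm.trans (from_id g))

end Coequalizable

section FinitelyGenerated

variable {I : Type u} [Category.{v} I]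

namespace FinitelyGeneratedCategory

theorem finite (hI : FinitelyGeneratedCategory I) : Finite I := by
  obtain ⟨S, hS, hgen⟩ := hI
  have exists_source : ∀ {X Y : I} (f : X ⟶ Y), ArrowClosure S f → ∃ s ∈ S, s.left = X := by
    intro X Y f hf
    induction hf with
    | of f hf => exact ⟨_, hf, rfl⟩
    | comp _ _ _ _ ih _ => exact ih
  exact Set.finite_univ_iff.1 ((hS.image Comma.left).subset fun X _ =>
    exists_source _ (hgen X X (𝟙 X)))

theorem fullSubcategory (hI : FinitelyGeneratedCategory I) {P : ObjectProperty I}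
    (hP : UpwardClosed P) : FinitelyGeneratedCategory P.FullSubcategory := by
  obtain ⟨S, hS, hgen⟩ := hI
  have restrict : ∀ {X Y : I} (f : X ⟶ Y) (hX : P X), ArrowClosure S f →
      ArrowClosure (P.ι.mapArrow.obj ⁻¹' S) (hP.homMk f hX) := by
    intro X Y f hX hf
    induction hf with
    | of f hf => exact .of _ hf
    | comp f g _ _ ihf ihg => exact .comp (hP.homMk f hX) (hP.homMk g _) (ihf hX) (ihg _)
  have mapArrow_injective : Function.Injective P.ι.mapArrow.obj := by
    rintro ⟨⟨_, _⟩, ⟨_, _⟩, ⟨_⟩⟩ ⟨⟨_, _⟩, ⟨_, _⟩, ⟨_⟩⟩ h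
    cases h
    rfl
  exact ⟨_, hS.preimage mapArrow_injective.injOn, fun X Y f =>
    restrict f.hom X.property (hgen _ _ f.hom)⟩

theorem nonempty_cocone_of_coequalizable (hI : FinitelyGeneratedCategory I) {C : Type u'}
    [Category.{v'} C] (hC : AmalgamationProperty C) {F : I ⥤ C} {D : C} (b : ∀ X, F.obj X ⟶ D)
    (hb : ∀ ⦃X Y : I⦄ (f : X ⟶ Y), Coequalizable (F.map f ≫ b Y) (b X)) :
    Nonempty (Limits.Cocone F) := by
  obtain ⟨S, hS, hgen⟩ := hI
  have := hS.to_subtype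
  obtain ⟨E, k, hk⟩ := hC.exists_coequalizing fun s : S => hb s.1.hom
  have comp_eq : ∀ {X Y : I} (f : X ⟶ Y), ArrowClosure S f → F.map f ≫ b Y ≫ k = b X ≫ k := by
    intro X Y f hf
    induction hf with
    | of f hf => exact (Category.assoc _ _ _).symm.trans (hk ⟨_, hf⟩)
    | comp f g _ _ ihf ihg => rw [F.map_comp, Category.assoc, ihg, ihf]
  exact ⟨E, { app X := b X ≫ k, naturality X Y f := by simp [comp_eq f (hgen X Y f)] }⟩

end FinitelyGeneratedCategory

end FinitelyGenerated

section MinimalObjects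

variable {I : Type u} [Category.{v} I]

/-- An object is minimal, in the preorder in which `X ≤ Y` if there is an arrow from `X` to `Y`. -/
def IsMinimalObject (x : I) : Prop :=
  ∀ ⦃z : I⦄, (z ⟶ x) → Nonempty (x ⟶ z)

theorem exists_isMinimalObject (I : Type u) [Category.{v} I] [Finite I] [Nonempty I] :
    ∃ x : I, IsMinimalObject x := by
  let _ : Preorder I :=
    { le X Y := Nonempty (X ⟶ Y)
      le_refl X := ⟨𝟙 X⟩
      le_trans := fun _ _ _ ⟨f⟩ ⟨g⟩ => ⟨f ≫ g⟩ }
  obtain ⟨x, hx⟩ := Set.finite_univ.exists_minimal (Set.univ_nonempty (α := I))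
  exact ⟨x, fun z f => hx.2 trivial ⟨f⟩⟩

/-- The class of the objects which have no arrow to `x`. -/
def notBelow (x : I) : ObjectProperty I :=
  fun z => IsEmpty (z ⟶ x)

theorem upwardClosed_notBelow (x : I) : UpwardClosed (notBelow x) :=
  fun _ _ f h => ⟨fun g => h.false (f ≫ g)⟩

theorem upwardClosed_objectProperty (c : ConnectedComponents I) :
    UpwardClosed c.objectProperty :=
  fun _ _ f h => Eq.trans (Quotient.sound' (Zigzag.of_inv f)) h

theorem IsMinimalObject.exists_hom_zigzag [CategoryTheory.IsPreconnected I] {x : I}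
    (hx : IsMinimalObject x) (w : (notBelow x).FullSubcategory) :
    ∃ (w' : (notBelow x).FullSubcategory) (_ : x ⟶ w'.obj), Zigzag w' w := by
  suffices ∀ z : I, z ∈ {z | ∀ hz : notBelow x z, ∃ (w' : (notBelow x).FullSubcategory)
      (_ : x ⟶ w'.obj), Zigzag w' ⟨z, hz⟩} from
    this w.obj w.property
  refine induct_on_objects _ (j₀ := x) (fun hz => (hz.false (𝟙 x)).elim) fun {y z} f => ⟨?_, ?_⟩
  · intro ih hz
    by_cases hy : notBelow x y
    · obtain ⟨w', g, h⟩ := ih hy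
      exact ⟨w', g, h.trans (.of_hom (ObjectProperty.homMk f))⟩
    · obtain ⟨g⟩ := not_isEmpty_iff.1 hy
      obtain ⟨i⟩ := hx g
      exact ⟨⟨z, hz⟩, i ≫ f, .refl _⟩
  · intro ih hy
    obtain ⟨w', g, h⟩ := ih (upwardClosed_notBelow x f hy)
    exact ⟨w', g, h.trans (.of_inv (ObjectProperty.homMk f))⟩

end MinimalObjects

section Cocones

variable {I : Type u} [Category.{v} I] {C : Type u'} [Category.{v'} C] {P : ObjectProperty I}
  {F : I ⥤ C}

theorem map_comp_cocone_app (β : Limits.Cocone (P.ι ⋙ F)) {X Y : I} (f : X ⟶ Y) (hX : P X)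
    (hY : P Y) : F.map f ≫ β.ι.app ⟨Y, hY⟩ = β.ι.app ⟨X, hX⟩ :=
  β.w (show (⟨X, hX⟩ : P.FullSubcategory) ⟶ ⟨Y, hY⟩ from ObjectProperty.homMk f)

/-- Cocones on the components of a category, all mapped to a common object, form a cocone. -/
def coconeOfComponents (a : ∀ c : CategoryTheory.ConnectedComponents I, Limits.Cocone (c.ι ⋙ F))
    {D : C} (k : ∀ c, (a c).pt ⟶ D) : Limits.Cocone F where
  pt := D
  ι :=
    { app X := (a (.mk X)).ι.app ⟨X, rfl⟩ ≫ k (.mk X)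
      naturality X Y f := by
        have hYX : CategoryTheory.ConnectedComponents.mk Y = .mk X :=
          Quotient.sound' (Zigzag.of_inv f)
        have app_eq : ∀ c (hY : c.objectProperty Y),
            (a (.mk Y)).ι.app ⟨Y, rfl⟩ ≫ k (.mk Y) = (a c).ι.app ⟨Y, hY⟩ ≫ k c := by
          rintro _ rfl
          rfl
        rw [app_eq _ hYX, ← Category.assoc, map_comp_cocone_app (a (.mk X)) f rfl hYX]
        exact (Category.comp_id _).symm }

theorem coconeOfComponents_app
    (a : ∀ c : CategoryTheory.ConnectedComponents I, Limits.Cocone (c.ι ⋙ F)) {D : C}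
    (k : ∀ c, (a c).pt ⟶ D) (c : CategoryTheory.ConnectedComponents I) (X : c.Component) :
    (coconeOfComponents a k).ι.app X.obj = (a c).ι.app X ≫ k c := by
  obtain ⟨X, rfl⟩ := X
  rfl

theorem exists_cocone_of_components [Finite (CategoryTheory.ConnectedComponents I)]
    (hC : AmalgamationProperty C)
    (a : ∀ c : CategoryTheory.ConnectedComponents I, Limits.Cocone (c.ι ⋙ F)) {A : C}
    (X : ∀ c : CategoryTheory.ConnectedComponents I, c.Component)
    (f : ∀ c, A ⟶ F.obj (X c).obj) :
    ∃ (β : Limits.Cocone F) (t : A ⟶ β.pt), ∀ c, f c ≫ β.ι.app (X c).obj = t := by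
  obtain ⟨D, t, k, hk⟩ := hC.exists_forall_comp_eq fun c => f c ≫ (a c).ι.app (X c)
  refine ⟨coconeOfComponents a k, t, fun c => ?_⟩
  rw [coconeOfComponents_app, ← hk c]
  exact (Category.assoc _ _ _).symm

variable {x : I}

/-- If every object outside `P` receives an arrow from `x`, the arrows into `P` are labelled by the
maps `F x ⟶ β.pt` which they induce, up to coequalizability. -/
noncomputable def coconeLabelling (hI : HasTrivialMonodromy.{v, u, v'} I)
    (hC : AmalgamationProperty C) (F : I ⥤ C) (β : Limits.Cocone (P.ι ⋙ F))
    (i : ∀ z, ¬ P z → (x ⟶ z)) : EntryLabelling P (CoequalizableClass hC (F.obj x) β.pt) where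
  label {X Y} f hX hY := .mk hC (F.map (i X hX ≫ f) ≫ β.ι.app ⟨Y, hY⟩)
  label_comp_of_mem {X Y Z} f g hX hY hZ := by
    simp only [F.map_comp, Category.assoc, map_comp_cocone_app β g hY hZ]
  label_comp_of_notMem f g hX hY hZ := CoequalizableClass.mk_eq_mk.2 <| by
    rw [← Category.assoc]
    exact (hI.coequalizable_map hC F _ _).comp_right hC _

theorem HasTrivialMonodromy.coequalizable_of_zigzag (hI : HasTrivialMonodromy.{v, u, v'} I)
    (hC : AmalgamationProperty C) (F : I ⥤ C) (hP : UpwardClosed P)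
    (β : Limits.Cocone (P.ι ⋙ F)) (i : ∀ z, ¬ P z → (x ⟶ z)) (hx : ¬ P x)
    {Y Z : P.FullSubcategory} (f : x ⟶ Y.obj) (g : x ⟶ Z.obj) (hYZ : Zigzag Y Z) :
    Coequalizable (F.map f ≫ β.ι.app Y) (F.map g ≫ β.ι.app Z) := by
  have precomp {W : P.FullSubcategory} (h : x ⟶ W.obj) :
      Coequalizable (F.map h ≫ β.ι.app W) (F.map (i x hx ≫ h) ≫ β.ι.app W) :=
    (hI.coequalizable_map hC F _ _).comp_right hC _
  have label_eq := (coconeLabelling hI hC F β i).label_eq_of_zigzag hI hP hx f g hYZ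
  exact (precomp f).trans hC (.trans hC (CoequalizableClass.mk_eq_mk.1 label_eq) (precomp g).symm)

theorem nonempty_cocone_of_fullSubcategory (hfg : FinitelyGeneratedCategory I)
    (hI : HasTrivialMonodromy.{v, u, v'} I) (hC : AmalgamationProperty C) (F : I ⥤ C)
    (hP : UpwardClosed P) (β : Limits.Cocone (P.ι ⋙ F)) (i : ∀ z, ¬ P z → (x ⟶ z))
    (j : ∀ z, ¬ P z → (z ⟶ x)) (t : F.obj x ⟶ β.pt)
    (ht : ∀ (w : P.FullSubcategory) (f : x ⟶ w.obj), Coequalizable (F.map f ≫ β.ι.app w) t) :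
    Nonempty (Limits.Cocone F) := by
  classical
  let b (z : I) : F.obj z ⟶ β.pt :=
    if hz : P z then β.ι.app ⟨z, hz⟩ else F.map (j z hz) ≫ t
  have b_of_mem {z : I} (hz : P z) : b z = β.ι.app ⟨z, hz⟩ := dif_pos hz
  have b_of_notMem {z : I} (hz : ¬ P z) : b z = F.map (j z hz) ≫ t := dif_neg hz
  refine hfg.nonempty_cocone_of_coequalizable hC b fun z w f => ?_
  by_cases hz : P z
  · rw [b_of_mem hz, b_of_mem (hP f hz), map_comp_cocone_app β f hz]
    exact .refl _
  by_cases hw : P w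
  · rw [b_of_notMem hz, b_of_mem hw]
    have through_x := (hI.coequalizable_map hC F f (j z hz ≫ i z hz ≫ f)).comp_right hC
      (β.ι.app ⟨w, hw⟩)
    refine through_x.trans hC ?_
    rw [F.map_comp, Category.assoc]
    exact (ht ⟨w, hw⟩ (i z hz ≫ f)).comp_left _
  · rw [b_of_notMem hz, b_of_notMem hw, ← Category.assoc, ← F.map_comp]
    exact (hI.coequalizable_map hC F _ _).comp_right hC t

theorem IsMinimalObject.nonempty_cocone [CategoryTheory.IsPreconnected I]
    (hx : IsMinimalObject x) (hfg : FinitelyGeneratedCategory I)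
    (hI : HasTrivialMonodromy.{v, u, v'} I) (hC : AmalgamationProperty C) (F : I ⥤ C)
    (hcomp : ∀ c : CategoryTheory.ConnectedComponents (notBelow x).FullSubcategory,
      Nonempty (Limits.Cocone (c.ι ⋙ (notBelow x).ι ⋙ F))) :
    Nonempty (Limits.Cocone F) := by
  have hP := upwardClosed_notBelow x
  have := (hfg.fullSubcategory hP).finite
  have : Finite (CategoryTheory.ConnectedComponents (notBelow x).FullSubcategory) :=
    Quotient.finite _
  have exists_entry (c : CategoryTheory.ConnectedComponents (notBelow x).FullSubcategory) :
      ∃ w : c.Component, Nonempty (x ⟶ w.obj.obj) := by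
    obtain ⟨v, rfl⟩ := Quotient.exists_rep c
    obtain ⟨w, f, h⟩ := hx.exists_hom_zigzag v
    exact ⟨⟨w, Quotient.sound' h⟩, ⟨f⟩⟩
  choose w hw using exists_entry
  obtain ⟨β, t, ht⟩ := exists_cocone_of_components (F := (notBelow x).ι ⋙ F) hC
    (fun c => (hcomp c).some) w fun c => F.map (hw c).some
  let j (z : I) (hz : ¬ notBelow x z) : z ⟶ x := (not_isEmpty_iff.1 hz).some
  let i (z : I) (hz : ¬ notBelow x z) : x ⟶ z := (hx (j z hz)).some
  refine nonempty_cocone_of_fullSubcategory hfg hI hC F hP β i j t fun v f => ?_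
  rw [← ht (.mk v)]
  exact hI.coequalizable_of_zigzag hC F hP β i (fun h => h.false (𝟙 x)) f _
    (Quotient.exact' (w (.mk v)).property.symm)

end Cocones

theorem HasTrivialMonodromy.nonempty_cocone {I : Type u} [Category.{v} I]
    [CategoryTheory.IsConnected I] {C : Type u'} [Category.{v'} C]
    (hI : HasTrivialMonodromy.{v, u, v'} I) (hfg : FinitelyGeneratedCategory I)
    (hC : AmalgamationProperty C) (F : I ⥤ C) : Nonempty (Limits.Cocone F) := by
  induction hn : Nat.card I using Nat.strong_induction_on generalizing I with
  | _ n ih =>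
    subst hn
    have := hfg.finite
    obtain ⟨x, hx⟩ := exists_isMinimalObject I
    refine hx.nonempty_cocone hfg hI hC F fun c => ?_
    have hW := upwardClosed_notBelow x
    have hc := upwardClosed_objectProperty c
    have card_component_lt : Nat.card c.Component < Nat.card I := calc
      _ ≤ Nat.card {z // notBelow x z} :=
        Nat.card_le_card_of_injective (fun w : c.Component => ⟨w.obj.obj, w.obj.property⟩)
          fun _ _ h => ObjectProperty.FullSubcategory.ext
            (ObjectProperty.FullSubcategory.ext (congrArg Subtype.val h))
      _ < Nat.card I := Finite.card_subtype_lt fun hx => hx.false (𝟙 x)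
    exact ih _ card_component_lt ((hI.fullSubcategory hW).fullSubcategory hc)
      ((hfg.fullSubcategory hW).fullSubcategory hc) _ rfl

theorem proposition5p7 {I : Type u} [Category.{v} I]
    (hfg : FinitelyGeneratedCategory I) (hconn : CategoryTheory.IsConnected I) (husc : UpwardSimplyConnected I)
    {C : Type u'} [Category.{v'} C] (hC : AmalgamationProperty C) (F : I ⥤ C) :
    Nonempty (Limits.Cocone F) :=
  husc.hasTrivialMonodromy.nonempty_cocone hfg hC F
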